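/- Let $N$ be a finite index set. For $x\in\mathbb{R}^N$ let $N(x)=\{z\in\mathbb{Z}^N : |x_i-z_i|<1 \ (i\in N)\}$. For a function $f:\mathbb{Z}^N\to\mathbb{R}\cup\{+\infty\}$ with nonempty effective domain $\operatorname{dom} f=\{x\in\mathbb{Z}^N : f(x)<+\infty\}$, the local convex extension $\tilde f$ of $f$ is defined for $x\in\mathbb{R}^N$ by $$\tilde f(x)=\inf\Big\{\sum_{y\in N(x)}\lambda_y f(y) \ :\ \sum_{y\in N(x)}\lambda_y y=x,\ \sum_{y\in N(x)}\lambda_y=1,\ \lambda_y\ge 0 \ (y\in N(x))\Big\}$$ (with $0\cdot(+\infty)=0$ and $\inf\emptyset=+\infty$), and $f$ is called integrally convex if $\tilde f$ is convex on $\mathbb{R}^N$. **Proposition.** Let $f:\mathbb{Z}^N\to\mathbb{R}\cup\{+\infty\}$ be integrally convex, let $U\subseteq N$, and let $g:\mathbb{Z}^U\to\mathbb{R}\cup\{-\infty,+\infty\}$ be the projection (partial minimization) of $f$ to $U$, $$g(y)=\inf\{f(y,z) : z\in\mathbb{Z}^{N\setminus U}\}\qquad(y\in\mathbb{Z}^U),$$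 where $(y,z)\in\mathbb{Z}^N$ has $i$-th component $y_i$ for $i\in U$ and $z_i$ for $i\in N\setminus U$. If $g(y^0)=-\infty$ for some $y^0\in\mathbb{Z}^U$, then $g(y)=-\infty$ for every $y\in\mathbb{Z}^U$ with $g(y)<+\infty$, that is, for every $y$ such that $(y,z)\in\operatorname{dom} f$ for some $z\in\mathbb{Z}^{N\setminus U}$. -/

import Mathlib

noncomputable section

/-- The integral neighborhood `N(x)` of a real vector `x`: the integer vectors `z` with
`⌊x i⌋ ≤ z i ≤ ⌈x i⌉` for all `i` (equivalently `|x i - z i| < 1` for all `i`, see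
`mem_integralNeighborhood`). -/
def integralNeighborhood {ι : Type*} [Fintype ι] (x : ι → ℝ) : Finset (ι → ℤ) :=
  open Classical in Fintype.piFinset fun i => Finset.Icc ⌊x i⌋ ⌈x i⌉

theorem mem_integralNeighborhood {ι : Type*} [Fintype ι] (x : ι → ℝ) (z : ι → ℤ) :
    z ∈ integralNeighborhood x ↔ ∀ i, |x i - (z i : ℝ)| < 1 := by
  classical
  simp only [integralNeighborhood, Fintype.mem_piFinset, Finset.mem_Icc]
  refine forall_congr' fun i => ?_
  rw [abs_sub_lt_iff, ← Int.lt_add_one_iff, Int.floor_lt, ← Int.sub_one_lt_iff, Int.lt_ceil]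
  push_cast
  constructor <;> rintro ⟨h1, h2⟩ <;> constructor <;> linarith

/-- `w` is a system of coefficients on `N(x)` that represents `x` as a convex combination of the
points of `N(x)`; the values of `w` outside `N(x)` play no role. -/
structure IsLocalConvexCombination {ι : Type*} [Fintype ι] (x : ι → ℝ)
    (w : (ι → ℤ) → ℝ) : Prop where
  nonneg : ∀ y ∈ integralNeighborhood x, 0 ≤ w y
  sum_eq_one : ∑ y ∈ integralNeighborhood x, w y = 1
  sum_eq : ∀ i, ∑ y ∈ integralNeighborhood x, w y * (y i : ℝ) = x i

/-- The local convex extension of `f`. Functions with values in `ℝ ∪ {+∞}` are modelled as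
`EReal`-valued functions that avoid `⊥`; the convention `0 * ⊤ = 0` of `EReal` is the usual one. -/
def localConvexExtension {ι : Type*} [Fintype ι] (f : (ι → ℤ) → EReal) (x : ι → ℝ) : EReal :=
  sInf {t : EReal | ∃ w : (ι → ℤ) → ℝ, IsLocalConvexCombination x w ∧
    t = ∑ y ∈ integralNeighborhood x, ((w y : ℝ) : EReal) * f y}

/-- Convexity on the whole space for functions with values in `ℝ ∪ {+∞}`. -/
def IsConvexFunction {ι : Type*} (g : (ι → ℝ) → EReal) : Prop :=
  ∀ (x y : ι → ℝ) (a b : ℝ), 0 ≤ a → 0 ≤ b → a + b = 1 →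
    g (a • x + b • y) ≤ (a : EReal) * g x + (b : EReal) * g y

/-- `f : ℤ^ι → ℝ ∪ {+∞}`, with nonempty effective domain, is integrally convex: its local convex
extension is convex on the whole space. -/
structure IsIntegrallyConvex {ι : Type*} [Fintype ι] (f : (ι → ℤ) → EReal) : Prop where
  ne_bot : ∀ x, f x ≠ ⊥
  nonempty_dom : ∃ x, f x < ⊤
  convex : IsConvexFunction (localConvexExtension f)

/-- The vector `(y, z)` whose component at `i` is `y i` for `i ∈ U` and `z i` for `i ∉ U`. -/
def combineVec {ι : Type*} (U : Set ι) (y : {i // i ∈ U} → ℤ) (z : {i // i ∉ U} → ℤ) : ι → ℤ :=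
  open Classical in fun i => if h : i ∈ U then y ⟨i, h⟩ else z ⟨i, h⟩

/-- The projection (partial minimization) of `f` to the coordinates in `U`. -/
def projectionFn {ι : Type*} (f : (ι → ℤ) → EReal) (U : Set ι) (y : {i // i ∈ U} → ℤ) : EReal :=
  ⨅ z : {i // i ∉ U} → ℤ, f (combineVec U y z)

end

/-! Suppose the projection is finite at `a`, and let `b` be an `ℓ¹`-nearest point to `a` where it is
`-∞`. Truncate fibers to boxes of radius `q`, with minima `ψ q` over `a` and `φ q → -∞` over `b`.
For large `q`, the affine interpolation of `ψ q` and `φ q` lies below the truncated projection on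
`[a, b]`: at every other point it tends to `-∞`, whereas the projection there is not `-∞`, by the
choice of `b`. Integral convexity at the midpoint of minimizers for radii `q` and `q + 2`, tested
against the interpolation for `q + 1`, yields `ψ (q + 1) + φ (q + 1) ≤ ψ q + φ (q + 2)`. This
telescopes and drags `ψ` to `-∞`. -/

/-! ### Affine minorants and the midpoint inequality. -/

theorem localConvexExtension_intCast_le {ι : Type*} [Fintype ι] (f : (ι → ℤ) → EReal)
    (x : ι → ℤ) : localConvexExtension f (fun i => (x i : ℝ)) ≤ f x := by
  have hN : integralNeighborhood (fun i => (x i : ℝ)) = {x} := by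
    ext z
    rw [mem_integralNeighborhood, Finset.mem_singleton, funext_iff]
    refine forall_congr' fun i => ?_
    rw [← Int.cast_sub, ← Int.cast_abs, ← Int.cast_one, Int.cast_lt, Int.abs_lt_one_iff]
    omega
  refine sInf_le ⟨fun _ => 1, ⟨?_, ?_, ?_⟩, ?_⟩ <;> simp [hN]

theorem ereal_coe_finset_sum {α : Type*} (s : Finset α) (g : α → ℝ) :
    ((∑ i ∈ s, g i : ℝ) : EReal) = ∑ i ∈ s, (g i : EReal) :=
  map_sum (⟨⟨Real.toEReal, EReal.coe_zero⟩, EReal.coe_add⟩ : ℝ →+ EReal) g s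

/-- An affine minorant of `f` on `N(x)` is a lower bound of the local convex extension at `x`. -/
theorem le_localConvexExtension {ι : Type*} [Fintype ι] (f : (ι → ℤ) → EReal) (x : ι → ℝ)
    (L : (ι → ℝ) →ₗ[ℝ] ℝ) (d : ℝ)
    (h : ∀ y ∈ integralNeighborhood x, ((d + L (fun i => (y i : ℝ)) : ℝ) : EReal) ≤ f y) :
    ((d + L x : ℝ) : EReal) ≤ localConvexExtension f x := by
  refine le_sInf ?_
  rintro _ ⟨w, hw, rfl⟩
  have hx : x = ∑ y ∈ integralNeighborhood x, w y • (fun i => (y i : ℝ)) := by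
    funext i
    simp [Finset.sum_apply, hw.sum_eq i]
  have hL : d + L x = ∑ y ∈ integralNeighborhood x, w y * (d + L (fun i => (y i : ℝ))) := by
    simp_rw [mul_add, Finset.sum_add_distrib, ← Finset.sum_mul, hw.sum_eq_one, one_mul]
    congr 1
    conv_lhs => rw [hx]
    simp [map_sum]
  rw [hL, ereal_coe_finset_sum]
  refine Finset.sum_le_sum fun y hy => ?_
  rw [EReal.coe_mul]
  exact mul_le_mul_of_nonneg_left (h y hy) (by exact_mod_cast hw.nonneg y hy)

/-- An affine minorant of an integrally convex function on the integral neighborhood of a midpoint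
of two integer points satisfies the midpoint inequality. -/
theorem IsIntegrallyConvex.affine_midpoint_le {ι : Type*} [Fintype ι] {f : (ι → ℤ) → EReal}
    (hf : IsIntegrallyConvex f) (x x' : ι → ℤ) (α β : ℝ) (hx : f x = α) (hx' : f x' = β)
    (L : (ι → ℝ) →ₗ[ℝ] ℝ) (d : ℝ)
    (h : ∀ y : ι → ℤ, (∀ i, |2 * y i - x i - x' i| ≤ 1) →
      ((d + L (fun i => (y i : ℝ)) : ℝ) : EReal) ≤ f y) :
    2 * d + L (fun i => (x i : ℝ)) + L (fun i => (x' i : ℝ)) ≤ α + β := by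
  have hc := hf.convex (fun i => (x i : ℝ)) (fun i => (x' i : ℝ)) (1 / 2) (1 / 2)
    (by norm_num) (by norm_num) (by norm_num)
  have hl := le_localConvexExtension f
    ((1 / 2 : ℝ) • (fun i => (x i : ℝ)) + (1 / 2 : ℝ) • (fun i => (x' i : ℝ))) L d ?_
  · have hu : ((1 / 2 : ℝ) : EReal) * localConvexExtension f (fun i => (x i : ℝ)) +
        ((1 / 2 : ℝ) : EReal) * localConvexExtension f (fun i => (x' i : ℝ)) ≤
        ((1 / 2 : ℝ) : EReal) * f x + ((1 / 2 : ℝ) : EReal) * f x' :=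
      add_le_add
        (mul_le_mul_of_nonneg_left (localConvexExtension_intCast_le f x)
          (EReal.coe_nonneg.2 (by norm_num)))
        (mul_le_mul_of_nonneg_left (localConvexExtension_intCast_le f x')
          (EReal.coe_nonneg.2 (by norm_num)))
    have := (hl.trans hc).trans hu
    rw [hx, hx', ← EReal.coe_mul, ← EReal.coe_mul, ← EReal.coe_add, EReal.coe_le_coe_iff,
      map_add, map_smul, map_smul, smul_eq_mul, smul_eq_mul] at this
    linarith
  · intro y hy
    rw [mem_integralNeighborhood] at hy
    refine h y fun i => ?_
    have hi := hy i
    simp only [Pi.add_apply, Pi.smul_apply, smul_eq_mul] at hi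
    rw [abs_lt] at hi
    rw [← Int.lt_add_one_iff, abs_lt]
    constructor
    · have : (-(1 + 1 : ℤ) : ℝ) < ((2 * y i - x i - x' i : ℤ) : ℝ) := by push_cast; linarith
      exact_mod_cast this
    · have : ((2 * y i - x i - x' i : ℤ) : ℝ) < ((1 + 1 : ℤ) : ℝ) := by push_cast; linarith
      exact_mod_cast this

/-! ### Truncating the projection to boxes. -/

theorem projectionFn_le {ι : Type*} (f : (ι → ℤ) → EReal) (U : Set ι) (x : ι → ℤ) :
    projectionFn f U (fun i => x i) ≤ f x := by
  refine (iInf_le (fun z => f (combineVec U (fun i => x i) z)) fun i => x i).trans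
    (le_of_eq (congrArg f ?_))
  funext i
  by_cases h : i ∈ U <;> simp [combineVec, h]

theorem exists_lt_of_projectionFn_lt {ι : Type*} {f : (ι → ℤ) → EReal} {U : Set ι}
    {y : {i // i ∈ U} → ℤ} {t : EReal} (h : projectionFn f U y < t) :
    ∃ x : ι → ℤ, (fun i : {i // i ∈ U} => x i) = y ∧ f x < t := by
  obtain ⟨z, hz⟩ := iInf_lt_iff.1 h
  refine ⟨_, ?_, hz⟩
  funext i
  simp [combineVec, i.2]

/-- The integer points whose components in `U` are those of `y` and whose other components
differ from those of `c` by at most `q`. -/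
def fiberBox {ι : Type*} (U : Set ι) (c : ι → ℤ) (y : {i // i ∈ U} → ℤ) (q : ℕ) :
    Set (ι → ℤ) :=
  {x | (fun i : {i // i ∈ U} => x i) = y ∧ ∀ i ∉ U, |x i - c i| ≤ q}

theorem fiberBox_finite {ι : Type*} [Finite ι] (U : Set ι) (c : ι → ℤ)
    (y : {i // i ∈ U} → ℤ) (q : ℕ) : (fiberBox U c y q).Finite := by
  classical
  refine (Set.Finite.pi' (t := fun i => if h : i ∈ U then {y ⟨i, h⟩}
    else Set.Icc (c i - q) (c i + q)) fun i => ?_).subset ?_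
  · split_ifs
    exacts [Set.finite_singleton _, Set.finite_Icc _ _]
  · rintro x ⟨rfl, hx⟩ i
    by_cases h : i ∈ U
    · simp [h]
    · have := abs_le.1 (hx i h)
      simp only [h, dite_false, Set.mem_Icc]
      omega

theorem fiberBox_nonempty {ι : Type*} (U : Set ι) (c : ι → ℤ)
    (y : {i // i ∈ U} → ℤ) (q : ℕ) : (fiberBox U c y q).Nonempty := by
  refine ⟨combineVec U y fun i => c i, ?_, fun i hi => ?_⟩
  · funext i
    simp [combineVec, i.2]
  · simp [combineVec, hi]

theorem fiberBox_mono {ι : Type*} (U : Set ι) (c : ι → ℤ) (y : {i // i ∈ U} → ℤ) :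
    Monotone (fiberBox U c y) := fun _ _ h _ hx =>
  ⟨hx.1, fun i hi => (hx.2 i hi).trans (by exact_mod_cast h)⟩

theorem exists_mem_fiberBox {ι : Type*} [Fintype ι] (U : Set ι) (c x : ι → ℤ) :
    ∃ q, x ∈ fiberBox U c (fun i => x i) q := by
  refine ⟨∑ i, (x i - c i).natAbs, rfl, fun i _ => ?_⟩
  rw [Int.abs_eq_natAbs]
  exact_mod_cast Finset.single_le_sum (f := fun i => (x i - c i).natAbs)
    (fun _ _ => Nat.zero_le _) (Finset.mem_univ i)

/-- The infimum of `f` over a fiber box. -/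
noncomputable def boxProjectionFn {ι : Type*} (f : (ι → ℤ) → EReal) (U : Set ι) (c : ι → ℤ)
    (y : {i // i ∈ U} → ℤ) (q : ℕ) : EReal :=
  sInf (f '' fiberBox U c y q)

section boxProjectionFn

variable {ι : Type*} (f : (ι → ℤ) → EReal) (U : Set ι) (c : ι → ℤ) (y : {i // i ∈ U} → ℤ)

theorem boxProjectionFn_antitone : Antitone (boxProjectionFn f U c y) := fun _ _ h =>
  sInf_le_sInf (Set.image_mono (fiberBox_mono U c y h))

theorem exists_eq_boxProjectionFn [Finite ι] (q : ℕ) :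
    ∃ x ∈ fiberBox U c y q, f x = boxProjectionFn f U c y q :=
  ((fiberBox_nonempty U c y q).image f).csInf_mem ((fiberBox_finite U c y q).image f)

theorem projectionFn_le_boxProjectionFn (q : ℕ) :
    projectionFn f U y ≤ boxProjectionFn f U c y q := by
  refine le_sInf ?_
  rintro _ ⟨x, ⟨rfl, -⟩, rfl⟩
  exact projectionFn_le f U x

variable {f U y}

theorem eventually_boxProjectionFn_lt [Fintype ι] {t : EReal} (h : projectionFn f U y < t) :
    ∀ᶠ q in Filter.atTop, boxProjectionFn f U c y q < t := by
  obtain ⟨x, rfl, hx⟩ := exists_lt_of_projectionFn_lt h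
  obtain ⟨q, hq⟩ := exists_mem_fiberBox U c x
  filter_upwards [Filter.eventually_ge_atTop q] with r hr
  exact (boxProjectionFn_antitone f U c _ hr).trans_lt ((sInf_le (Set.mem_image_of_mem f hq)).trans_lt hx)

theorem boxProjectionFn_ne_bot [Finite ι] (hf : ∀ x, f x ≠ ⊥) (q : ℕ) :
    boxProjectionFn f U c y q ≠ ⊥ := by
  obtain ⟨x, -, hx⟩ := exists_eq_boxProjectionFn f U c y q
  exact hx ▸ hf x

end boxProjectionFn

/-- The neighbors of the midpoint of two points from boxes of radii `q` and `q + 2` lie in the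
boxes of radius `q + 1`. -/
theorem mem_fiberBox_of_near_midpoint {ι : Type*} {U : Set ι} {c x x' v : ι → ℤ}
    {a b : {i // i ∈ U} → ℤ} {q : ℕ} (hx : x ∈ fiberBox U c a q)
    (hx' : x' ∈ fiberBox U c b (q + 2)) (hv : ∀ i, |2 * v i - x i - x' i| ≤ 1) :
    v ∈ fiberBox U c (fun i => v i) (q + 1) := by
  refine ⟨rfl, fun i hi => ?_⟩
  have h1 := abs_le.1 (hx.2 i hi)
  have h2 := abs_le.1 (hx'.2 i hi)
  have h3 := abs_le.1 (hv i)
  push_cast at h2 ⊢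
  rw [abs_le]
  omega

/-! ### The telescoping argument. -/

/-- Rearranged, the hypothesis says that `ψ q - φ (q + 1)` is eventually nonincreasing, so `ψ q` is
at most `φ (q + 1)` plus a constant. -/
theorem not_bddBelow_of_telescope {φ ψ : ℕ → ℝ} (hφ : Filter.Tendsto φ Filter.atTop Filter.atBot)
    (h : ∀ᶠ q in Filter.atTop, ψ (q + 1) + φ (q + 1) ≤ ψ q + φ (q + 2)) (M : ℝ) :
    ∃ q, ψ q < M := by
  obtain ⟨Q, hQ⟩ := Filter.eventually_atTop.1 h
  have hD : ∀ q ≥ Q, ψ q - φ (q + 1) ≤ ψ Q - φ (Q + 1) := by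
    intro q hq
    induction q, hq using Nat.le_induction with
    | base => exact le_rfl
    | succ q hq ih => linarith [hQ q hq]
  obtain ⟨q, hq, hlt⟩ := ((Filter.eventually_ge_atTop Q).and
    (((Filter.tendsto_add_atTop_iff_nat 1).2 hφ).eventually_lt_atBot
      (M - (ψ Q - φ (Q + 1))))).exists
  exact ⟨q, by linarith [hD q hq]⟩

theorem proposition3p3 {ι : Type*} [Fintype ι] (f : (ι → ℤ) → EReal)
    (hf : IsIntegrallyConvex f) (U : Set ι)
    (y₀ : {i // i ∈ U} → ℤ) (hy₀ : projectionFn f U y₀ = ⊥) :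
    ∀ y : {i // i ∈ U} → ℤ, projectionFn f U y < ⊤ → projectionFn f U y = ⊥ := by
  classical
  intro a ha
  by_contra hne
  let n : ({i // i ∈ U} → ℤ) → ℤ := fun y => ∑ i, |y i - a i|
  have hn0 : ∀ y, 0 ≤ n y := fun y => Finset.sum_nonneg fun i _ => abs_nonneg _
  -- a nearest point `b` to `a` at which the projection takes the value `-∞`
  obtain ⟨b, hb, hmin⟩ : ∃ b, projectionFn f U b = ⊥ ∧
      ∀ y, n y < n b → projectionFn f U y ≠ ⊥ := by
    have hex : ∃ k : ℕ, ∃ y, projectionFn f U y = ⊥ ∧ (n y).toNat = k := ⟨_, y₀, hy₀, rfl⟩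
    obtain ⟨b, hb, hbk⟩ := Nat.find_spec hex
    refine ⟨b, hb, fun y hy hy' => Nat.find_min hex (m := (n y).toNat) ?_ ⟨y, hy', rfl⟩⟩
    have := hn0 y
    omega
  have hnb : 0 < n b := by
    refine (hn0 b).lt_of_ne fun h => hne ?_
    have hba : b = a := by
      funext i
      have := (Finset.sum_eq_zero_iff_of_nonneg fun i _ => abs_nonneg _).1 h.symm i
        (Finset.mem_univ i)
      have := abs_eq_zero.1 this
      omega
    rw [← hba, hb]
  have hnbR : (0 : ℝ) < n b := by exact_mod_cast hnb
  -- Boxes centered at `c` all contain `c` over `a`, so `ψ` is a genuine minimum for every `q`.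
  obtain ⟨c, hca, hc⟩ := exists_lt_of_projectionFn_lt ha
  let G := boxProjectionFn f U c
  have hGbot : ∀ y q, G y q ≠ ⊥ := fun y q => boxProjectionFn_ne_bot c hf.ne_bot q
  have hGa : ∀ q, G a q ≠ ⊤ := fun q =>
    ((sInf_le ⟨c, ⟨hca, fun i _ => by simp⟩, rfl⟩ : G a q ≤ f c).trans_lt hc).ne
  let ψ : ℕ → ℝ := fun q => (G a q).toReal
  -- A small box over `b` may miss `dom f`; `toReal` then returns the junk value `0`, so `φ` is
  -- meaningful only eventually.
  let φ : ℕ → ℝ := fun q => (G b q).toReal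
  have hψ : ∀ q, (ψ q : EReal) = G a q := fun q => EReal.coe_toReal (hGa q) (hGbot a q)
  have hφ : ∀ᶠ q in Filter.atTop, (φ q : EReal) = G b q := by
    filter_upwards [eventually_boxProjectionFn_lt c (hb ▸ bot_lt_top)] with q hq
    exact EReal.coe_toReal hq.ne (hGbot b q)
  have hφlim : Filter.Tendsto φ Filter.atTop Filter.atBot := by
    refine Filter.tendsto_atBot.2 fun M => ?_
    filter_upwards [hφ, eventually_boxProjectionFn_lt (t := (M : EReal)) c
      (hb ▸ EReal.bot_lt_coe M)] with q h1 h2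
    exact_mod_cast (h1.trans_lt h2).le
  -- the affine function equal to `ψ q` over `a` and to `φ q` over `b` is a minorant
  have hminorant : ∀ᶠ q in Filter.atTop, ∀ y ∈ Set.uIcc a b,
      ((ψ q + (φ q - ψ q) * (n y / n b) : ℝ) : EReal) ≤ G y q := by
    refine (Filter.eventually_all_finite (Set.finite_Icc _ _)).2 fun y hy => ?_
    have hyi : ∀ i, a i ⊓ b i ≤ y i ∧ y i ≤ a i ⊔ b i := fun i => ⟨hy.1 i, hy.2 i⟩
    have hle : ∀ i, |y i - a i| ≤ |b i - a i| := fun i => by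
      have := hyi i
      grind
    by_cases hyb : y = b
    · subst hyb
      filter_upwards [hφ] with q hq
      rw [div_self hnbR.ne', mul_one, add_sub_cancel, hq]
    by_cases hya : y = a
    · subst hya
      refine Filter.Eventually.of_forall fun q => ?_
      have : n y = 0 := by simp [n]
      simp [this, hψ]
    have hlt : n y < n b := by
      obtain ⟨i, hi⟩ := Function.ne_iff.1 hyb
      refine Finset.sum_lt_sum (fun i _ => hle i) ⟨i, Finset.mem_univ i, ?_⟩
      have := hyi i
      grind
    have hpos : 0 < n y := by
      obtain ⟨i, hi⟩ := Function.ne_iff.1 hya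
      exact Finset.sum_pos' (fun i _ => abs_nonneg _)
        ⟨i, Finset.mem_univ i, abs_pos.2 (sub_ne_zero.2 hi)⟩
    obtain ⟨M, -, hM⟩ := EReal.lt_iff_exists_real_btwn.1 (bot_lt_iff_ne_bot.2 (hmin y hlt))
    have hθ : (0 : ℝ) < n y / n b := div_pos (by exact_mod_cast hpos) hnbR
    have hθ1 : (n y / n b : ℝ) < 1 := (div_lt_one hnbR).2 (by exact_mod_cast hlt)
    -- With `θ = n y / n b`, the interpolation `(1 - θ) ψ q + θ φ q` is at most `|ψ 0| + θ φ q`,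
    -- hence at most `M`. The absolute value allows dropping the factor `1 - θ`.
    filter_upwards [hφlim.eventually_le_atBot ((M - |ψ 0|) / (n y / n b))] with q hq
    have hψ0 : ψ q ≤ |ψ 0| := by
      refine le_trans ?_ (le_abs_self _)
      have := boxProjectionFn_antitone f U c a (Nat.zero_le q)
      change G a q ≤ G a 0 at this
      rw [← hψ, ← hψ] at this
      exact_mod_cast this
    rw [le_div_iff₀ hθ] at hq
    refine le_trans (EReal.coe_le_coe_iff.2 (?_ : _ ≤ M))
      (hM.le.trans (projectionFn_le_boxProjectionFn f U c y q))
    nlinarith [abs_nonneg (ψ 0)]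
  -- `y ↦ n y` is affine on `[a, b]`
  let ℓ : (ι → ℝ) →ₗ[ℝ] ℝ :=
    ∑ i : {i // i ∈ U}, ((b i - a i).sign : ℝ) • LinearMap.proj (i : ι)
  have hℓ : ∀ x : ι → ℤ, (fun i : {i // i ∈ U} => x i) ∈ Set.uIcc a b →
      ℓ (fun i => (x i : ℝ)) = ℓ (fun i => (c i : ℝ)) + n (fun i => x i) := by
    intro x hx
    rw [← sub_eq_iff_eq_add', ← map_sub]
    simp only [ℓ, n, LinearMap.sum_apply, LinearMap.smul_apply, LinearMap.proj_apply,
      smul_eq_mul, Pi.sub_apply, Int.cast_sum]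
    refine Finset.sum_congr rfl fun i _ => ?_
    have h1 : a i ⊓ b i ≤ x i := hx.1 i
    have h2 : x i ≤ a i ⊔ b i := hx.2 i
    rw [show c i = a i from congrFun hca i, ← Int.cast_sub, ← Int.cast_mul, Int.cast_inj]
    rcases lt_trichotomy (a i) (b i) with h | h | h
    · rw [Int.sign_eq_one_of_pos (by omega), one_mul, abs_of_nonneg (by omega)]
    · have : x i - a i = 0 := by omega
      simp [this]
    · rw [Int.sign_eq_neg_one_of_neg (by omega), abs_of_nonpos (by omega)]
      omega
  have htel : ∀ᶠ q in Filter.atTop, ψ (q + 1) + φ (q + 1) ≤ ψ q + φ (q + 2) := by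
    filter_upwards [(Filter.tendsto_add_atTop_nat 1).eventually hminorant,
      (Filter.tendsto_add_atTop_nat 2).eventually hφ] with q hq hφq
    obtain ⟨x, hx, hfx⟩ := exists_eq_boxProjectionFn f U c a q
    obtain ⟨x', hx', hfx'⟩ := exists_eq_boxProjectionFn f U c b (q + 2)
    -- Slope of the interpolation per unit of `n`; subtracting `s * ℓ c` makes its value over `a`
    -- equal to `ψ (q + 1)`.
    set s := (φ (q + 1) - ψ (q + 1)) / n b with hs
    have key := hf.affine_midpoint_le x x' (ψ q) (φ (q + 2)) (hfx.trans (hψ q).symm)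
      (hfx'.trans hφq.symm) (s • ℓ) (ψ (q + 1) - s * ℓ (fun i => (c i : ℝ))) ?_
    · have e1 := hℓ x (hx.1 ▸ Set.left_mem_uIcc)
      have e2 := hℓ x' (hx'.1 ▸ Set.right_mem_uIcc)
      rw [hx.1, show n a = 0 by simp [n]] at e1
      rw [hx'.1] at e2
      have e3 : s * n b = φ (q + 1) - ψ (q + 1) := div_mul_cancel₀ _ hnbR.ne'
      simp only [LinearMap.smul_apply, smul_eq_mul, e1, e2, Int.cast_zero, add_zero,
        mul_add] at key
      linarith
    · intro v hv
      -- Integrality: an integer within `1 / 2` of the midpoint of two integers lies between them.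
      have hvU : (fun i : {i // i ∈ U} => v i) ∈ Set.uIcc a b := by
        have hi : ∀ i : {i // i ∈ U}, a i ⊓ b i ≤ v i ∧ v i ≤ a i ⊔ b i := fun i => by
          have h1 := congrFun hx.1 i
          have h2 := congrFun hx'.1 i
          have h3 := abs_le.1 (hv i)
          omega
        exact ⟨fun i => (hi i).1, fun i => (hi i).2⟩
      have hmem := mem_fiberBox_of_near_midpoint hx hx' hv
      refine le_trans (le_of_eq ?_) ((hq _ hvU).trans (sInf_le ⟨v, hmem, rfl⟩))
      rw [EReal.coe_eq_coe_iff, LinearMap.smul_apply, smul_eq_mul, hℓ v hvU, hs]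
      ring
  obtain ⟨M, -, hM⟩ := EReal.lt_iff_exists_real_btwn.1 (bot_lt_iff_ne_bot.2 hne)
  obtain ⟨q, hq⟩ := not_bddBelow_of_telescope hφlim htel M
  have := hM.le.trans (projectionFn_le_boxProjectionFn f U c a q)
  change (M : EReal) ≤ G a q at this
  rw [← hψ, EReal.coe_le_coe_iff] at this
  linarith
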